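/- Let $\mathbb D(0,r)=\{z\in\mathbb C:|z|<r\}$, $\mathbb D=\mathbb D(0,1)$, and let $dA=dx\,dy/\pi$ be the normalized area measure on $\mathbb C$. For $0<r<1$ and a polynomial $f$ with complex coefficients put $$ \Phi_f(z,r)=\left((1-|z|^2)\,|f(z)|-1_{\mathbb D(0,r)}(z)\right)^2,\qquad z\in\mathbb D, $$ $$ \rho_{\mathbb H,r}(f)=\frac{\int_{\mathbb D(0,r)}\Phi_f(z,r)\,\frac{dA(z)}{1-|z|^2}}{\int_{\mathbb D(0,r)}\frac{dA(z)}{1-|z|^2}},\qquad \rho^*_{\mathbb H,r}(f)=\frac{\int_{\mathbb D}\Phi_f(z,r)\,\frac{dA(z)}{1-|z|^2}}{\int_{\mathbb D(0,r)}\frac{dA(z)}{1-|z|^2}} . $$ Define the hyperbolic discrepancy density and the tight hyperbolic discrepancy density by $$ \rho_{\mathbb H}=\liminf_{r\to1^-}\,\inf_f\,\rho_{\mathbb H,r}(f),\qquad \rho^*_{\mathbb H}=\liminf_{r\to1^-}\,\inf_f\,\rho^*_{\mathbb H,r}(f), $$ where both infima are over all polynomials $f$ with complex coefficients. **Theorem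 1.2.** $\rho_{\mathbb H}=\rho^*_{\mathbb H}$. -/

import Mathlib

open MeasureTheory Filter Topology

noncomputable section

/-- The normalized area measure `dA = dx dy / π` on the complex plane. -/
def normArea : Measure ℂ := (ENNReal.ofReal Real.pi)⁻¹ • (volume : Measure ℂ)

/-- The hyperbolic discrepancy function
`Φ_f(z, r) = ((1 - |z|²) |f(z)| - 1_{𝔻(0,r)}(z))²`. -/
def hypDiscrepancy (f : ℂ → ℂ) (z : ℂ) (r : ℝ) : ℝ :=
  ((1 - ‖z‖ ^ 2) * ‖f z‖ - (Metric.ball (0 : ℂ) r).indicator (fun _ => (1 : ℝ)) z) ^ 2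

/-- The integral of `dA(z) / (1 - |z|²)` over the disc `𝔻(0,r)`. -/
def hypNormalizer (r : ℝ) : ℝ :=
  ∫ z in Metric.ball (0 : ℂ) r, 1 / (1 - ‖z‖ ^ 2) ∂normArea

/-- The functional `ρ_{ℍ,r}(f)`: the normalized integral of `Φ_f(·, r)` over `𝔻(0,r)`. -/
def rhoHr (r : ℝ) (f : Polynomial ℂ) : ℝ :=
  (∫ z in Metric.ball (0 : ℂ) r,
    hypDiscrepancy (fun w => f.eval w) z r / (1 - ‖z‖ ^ 2) ∂normArea) / hypNormalizer r

/-- The functional `ρ*_{ℍ,r}(f)`: the integral of `Φ_f(·, r)` is now over the whole unit disc,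
with the same normalization. -/
def rhoHrStar (r : ℝ) (f : Polynomial ℂ) : ℝ :=
  (∫ z in Metric.ball (0 : ℂ) 1,
    hypDiscrepancy (fun w => f.eval w) z r / (1 - ‖z‖ ^ 2) ∂normArea) / hypNormalizer r

/-- The hyperbolic discrepancy density `ρ_ℍ`: the lower limit, as `r` tends to `1` from below, of
the infimum over all polynomials of `ρ_{ℍ,r}`. -/
def rhoH : ℝ := liminf (fun r : ℝ => ⨅ f : Polynomial ℂ, rhoHr r f) (𝓝[<] (1 : ℝ))

/-- The tight hyperbolic discrepancy density `ρ*_ℍ`. -/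
def rhoHStar : ℝ := liminf (fun r : ℝ => ⨅ f : Polynomial ℂ, rhoHrStar r f) (𝓝[<] (1 : ℝ))

end

/-!
Clearly `ρ_{ℍ,r} ≤ ρ*_{ℍ,r}`. Conversely, given `f`, use the dilate `f_r(z) = f(rz)` in `ρ*_{ℍ,r}`.
Write `E_R` and `M_R` for the integrals of `(1 - |z|²)|f|²` and `|f|` over `𝔻(0,R)`, and `N(r)` for
the normalizer. Expanding the square gives `N(r) ρ_{ℍ,r}(f) = E_r - 2 M_r + N(r)`, and for
`N(r) ρ*_{ℍ,r}(f)` the same with `E_1` in place of `E_r`. As `1 - |z|²/r² ≤ 1 - |z|²`, a change of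
variables gives `r² N(r) ρ*_{ℍ,r}(f_r) ≤ E_r - 2 M_{r²} + N(r)`, so that only the mass of `|f|` on
the annulus `r² ≤ |z| < r` is lost. That annulus has hyperbolic area at most `1` while
`N(r) → ∞`, so by the AM-GM inequality the loss is negligible compared with `N(r)`.
-/

open Metric Set

lemma liminf_eq_liminf_of_tendsto_sub {ι : Type*} {l : Filter ι} [l.NeBot] {u v : ι → ℝ}
    (hle : IsBoundedUnder (· ≤ ·) l u) (hge : IsBoundedUnder (· ≥ ·) l u)
    (h : Tendsto (fun i => v i - u i) l (𝓝 0)) : liminf u l = liminf v l := by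
  have hv : (fun i => v i - u i) + u = v := by ext i; simp
  apply le_antisymm
  · simpa [hv, h.liminf_eq] using le_liminf_add (f := l) (u := fun i => v i - u i) (v := u)
      h.isBoundedUnder_ge h.isBoundedUnder_le hge hle.isCoboundedUnder_ge
  · simpa [hv, h.limsup_eq] using liminf_add_le (f := l) (u := fun i => v i - u i) (v := u)
      h.isBoundedUnder_ge h.isBoundedUnder_le hge hle.isCoboundedUnder_ge

lemma two_mul_integral_le_of_pos {α : Type*} [MeasurableSpace α] {μ : Measure α} {w g : α → ℝ}
    (hw : ∀ᵐ x ∂μ, 0 < w x) (hg : Integrable g μ) (hwg : Integrable (fun x => w x * g x ^ 2) μ)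
    (hw' : Integrable (fun x => 1 / w x) μ) {ε : ℝ} (hε : 0 < ε) :
    2 * ∫ x, g x ∂μ ≤ ε * ∫ x, w x * g x ^ 2 ∂μ + ε⁻¹ * ∫ x, 1 / w x ∂μ := by
  rw [← integral_const_mul, ← integral_const_mul, ← integral_const_mul,
    ← integral_add (hwg.const_mul ε) (hw'.const_mul ε⁻¹)]
  refine integral_mono_ae (hg.const_mul 2) ((hwg.const_mul ε).add (hw'.const_mul ε⁻¹)) ?_
  filter_upwards [hw] with x hx
  have hsq : ε * (w x * g x ^ 2) + ε⁻¹ * (1 / w x) - 2 * g x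
      = (ε * w x * g x - 1) ^ 2 / (ε * w x) := by
    field_simp
    ring
  exact sub_nonneg.1 (hsq ▸ by positivity)

instance isAddHaarMeasure_normArea : normArea.IsAddHaarMeasure :=
  Measure.IsAddHaarMeasure.smul _ (by simp) (by simp [Real.pi_pos])

lemma normArea_real_ball_one : normArea.real (ball (0 : ℂ) 1) = 1 := by
  have hpi : (NNReal.pi : ENNReal) = ENNReal.ofReal Real.pi := by
    rw [← NNReal.coe_real_pi, ENNReal.ofReal_coe_nnreal]
  simp [normArea, Measure.real, hpi, ENNReal.toReal_ofReal Real.pi_pos.le, Real.pi_ne_zero]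

lemma setIntegral_ball_fun_norm_normArea {r : ℝ} (hr : 0 ≤ r) (g : ℝ → ℝ) :
    ∫ z in ball (0 : ℂ) r, g ‖z‖ ∂normArea = 2 * ∫ t in (0 : ℝ)..r, t * g t := by
  have hind : (ball (0 : ℂ) r).indicator (fun z => g ‖z‖) = fun z => (Iio r).indicator g ‖z‖ := by
    ext z
    simp [indicator]
  rw [← integral_indicator measurableSet_ball, hind, integral_fun_norm_addHaar,
    normArea_real_ball_one, Complex.finrank_real_complex, intervalIntegral.integral_of_le hr,
    integral_Ioc_eq_integral_Ioo, ← Ioi_inter_Iio, ← setIntegral_indicator measurableSet_Iio]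
  simp [indicator]

lemma integrableOn_ball_of_continuous {g : ℂ → ℝ} (hg : Continuous g) (R : ℝ) :
    IntegrableOn g (ball (0 : ℂ) R) normArea :=
  (hg.continuousOn.integrableOn_compact (isCompact_closedBall 0 R)).mono_set ball_subset_closedBall

lemma one_sub_sq_norm_pos {z : ℂ} (hz : ‖z‖ < 1) : 0 < 1 - ‖z‖ ^ 2 :=
  sub_pos.2 (pow_lt_one₀ (norm_nonneg z) hz two_ne_zero)

lemma integrableOn_ball_one_div_one_sub_sq_norm {r : ℝ} (hr : r < 1) :
    IntegrableOn (fun z : ℂ => 1 / (1 - ‖z‖ ^ 2)) (ball 0 r) normArea := by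
  refine (ContinuousOn.integrableOn_compact (isCompact_closedBall (0 : ℂ) r)
    (continuousOn_const.div (by fun_prop) fun z hz => ?_)).mono_set ball_subset_closedBall
  exact (one_sub_sq_norm_pos ((mem_closedBall_zero_iff.1 hz).trans_lt hr)).ne'

lemma hypNormalizer_eq_neg_log {r : ℝ} (hr0 : 0 ≤ r) (hr1 : r < 1) :
    hypNormalizer r = -Real.log (1 - r ^ 2) := by
  have hpos : ∀ t ∈ uIcc 0 r, 0 < 1 - t ^ 2 := fun t ht => by
    rw [uIcc_of_le hr0] at ht
    exact sub_pos.2 (pow_lt_one₀ ht.1 (ht.2.trans_lt hr1) two_ne_zero)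
  have hderiv : ∀ t ∈ uIcc 0 r, HasDerivAt (fun t => -Real.log (1 - t ^ 2) / 2)
      (t * (1 / (1 - t ^ 2))) t := fun t ht => by
    refine ((((hasDerivAt_pow 2 t).const_sub 1).log (hpos t ht).ne').neg.div_const 2).congr_deriv ?_
    norm_num
    ring
  have hint : IntervalIntegrable (fun t : ℝ => t * (1 / (1 - t ^ 2))) volume 0 r :=
    (continuousOn_id.mul (continuousOn_const.div (by fun_prop)
      fun t ht => (hpos t ht).ne')).intervalIntegrable
  rw [hypNormalizer, setIntegral_ball_fun_norm_normArea hr0 fun t => 1 / (1 - t ^ 2),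
    intervalIntegral.integral_eq_sub_of_hasDerivAt hderiv hint]
  simp
  ring

lemma hypNormalizer_pos {r : ℝ} (hr0 : 0 < r) (hr1 : r < 1) : 0 < hypNormalizer r := by
  rw [hypNormalizer_eq_neg_log hr0.le hr1]
  exact neg_pos.2 (Real.log_neg (by nlinarith) (by nlinarith))

lemma hypNormalizer_sub_hypNormalizer_sq_le_one {r : ℝ} (hr0 : 0 ≤ r) (hr1 : r < 1) :
    hypNormalizer r - hypNormalizer (r ^ 2) ≤ 1 := by
  have hsq : r ^ 2 < 1 := pow_lt_one₀ hr0 hr1 two_ne_zero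
  have hlog : Real.log (1 - (r ^ 2) ^ 2) = Real.log (1 - r ^ 2) + Real.log (1 + r ^ 2) := by
    rw [← Real.log_mul (by linarith) (by positivity)]
    ring_nf
  rw [hypNormalizer_eq_neg_log hr0 hr1, hypNormalizer_eq_neg_log (sq_nonneg r) hsq, hlog]
  linarith [Real.log_le_sub_one_of_pos (by positivity : 0 < 1 + r ^ 2)]

lemma tendsto_hypNormalizer_atTop : Tendsto hypNormalizer (𝓝[<] 1) atTop := by
  have hpos : ∀ᶠ r : ℝ in 𝓝[<] 1, r ∈ Ioo 0 1 := Ioo_mem_nhdsLT zero_lt_one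
  have hone_sub : Tendsto (fun r : ℝ => 1 - r ^ 2) (𝓝[<] 1) (𝓝[>] 0) := by
    refine tendsto_nhdsWithin_iff.2 ⟨?_, hpos.mono fun r hr =>
      sub_pos.2 (pow_lt_one₀ hr.1.le hr.2 two_ne_zero)⟩
    exact tendsto_nhdsWithin_of_tendsto_nhds (Continuous.tendsto' (by fun_prop) _ _ (by simp))
  refine (tendsto_neg_atBot_atTop.comp (Real.tendsto_log_nhdsGT_zero.comp hone_sub)).congr' ?_
  exact hpos.mono fun r hr => (hypNormalizer_eq_neg_log hr.1.le hr.2).symm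

/-- The squared norm of `f` in the weighted Bergman space on `𝔻(0, R)` with weight `1 - |z|²`: the
quadratic term of the expanded discrepancy. -/
noncomputable def bergmanEnergy (R : ℝ) (f : ℂ → ℂ) : ℝ :=
  ∫ z in ball (0 : ℂ) R, (1 - ‖z‖ ^ 2) * ‖f z‖ ^ 2 ∂normArea

/-- The `L¹` norm of `f` on `𝔻(0, R)`: the cross term of the expanded discrepancy. -/
noncomputable def diskMass (R : ℝ) (f : ℂ → ℂ) : ℝ :=
  ∫ z in ball (0 : ℂ) R, ‖f z‖ ∂normArea

section ContinuousFunction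

variable {f : ℂ → ℂ}

lemma setIntegral_one_sub_sq_norm_mul_le_bergmanEnergy (hf : Continuous f) {S : Set ℂ} {R : ℝ}
    (hS : S ⊆ ball 0 R) (hR : R ≤ 1) :
    ∫ z in S, (1 - ‖z‖ ^ 2) * ‖f z‖ ^ 2 ∂normArea ≤ bergmanEnergy R f := by
  refine setIntegral_mono_set (integrableOn_ball_of_continuous (by fun_prop) R) ?_ hS.eventuallyLE
  filter_upwards [ae_restrict_mem measurableSet_ball] with z hz
  have hpos := one_sub_sq_norm_pos ((mem_ball_zero_iff.1 hz).trans_le hR)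
  exact mul_nonneg hpos.le (sq_nonneg _)

lemma setIntegral_hypDiscrepancy_div (hf : Continuous f) {r R : ℝ} (hr : r < 1) (hrR : r ≤ R)
    (hR : R ≤ 1) :
    ∫ z in ball (0 : ℂ) R, hypDiscrepancy f z r / (1 - ‖z‖ ^ 2) ∂normArea
      = bergmanEnergy R f - 2 * diskMass r f + hypNormalizer r := by
  have hexpand : ∀ z ∈ ball (0 : ℂ) R, hypDiscrepancy f z r / (1 - ‖z‖ ^ 2) =
      (1 - ‖z‖ ^ 2) * ‖f z‖ ^ 2 - (ball 0 r).indicator (fun z => 2 * ‖f z‖) z +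
        (ball 0 r).indicator (fun z => 1 / (1 - ‖z‖ ^ 2)) z := fun z hz => by
    have hpos := one_sub_sq_norm_pos ((mem_ball_zero_iff.1 hz).trans_le hR)
    by_cases hzr : z ∈ ball (0 : ℂ) r
    · simp only [hypDiscrepancy, indicator_of_mem hzr]
      field_simp
      ring
    · simp only [hypDiscrepancy, indicator_of_notMem hzr]
      field_simp
      ring
  have hquad : IntegrableOn (fun z : ℂ => (1 - ‖z‖ ^ 2) * ‖f z‖ ^ 2) (ball 0 R) normArea :=
    integrableOn_ball_of_continuous (by fun_prop) R
  have hcross : IntegrableOn ((ball 0 r).indicator fun z => 2 * ‖f z‖) (ball 0 R) normArea :=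
    (integrableOn_ball_of_continuous (by fun_prop) R).indicator measurableSet_ball
  have hconst : IntegrableOn ((ball (0 : ℂ) r).indicator fun z => 1 / (1 - ‖z‖ ^ 2))
      (ball 0 R) normArea :=
    ((integrable_indicator_iff measurableSet_ball).2
      (integrableOn_ball_one_div_one_sub_sq_norm hr)).integrableOn
  have hinter : ball (0 : ℂ) R ∩ ball 0 r = ball 0 r := inter_eq_right.2 (ball_subset_ball hrR)
  rw [setIntegral_congr_fun measurableSet_ball hexpand,
    integral_add (by exact hquad.sub hcross) hconst, integral_sub hquad hcross,
    setIntegral_indicator measurableSet_ball, setIntegral_indicator measurableSet_ball, hinter,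
    integral_const_mul]
  rfl

lemma two_mul_diskMass_sub_le (hf : Continuous f) {s r ε : ℝ} (hsr : s ≤ r) (hr : r < 1)
    (hε : 0 < ε) :
    2 * (diskMass r f - diskMass s f) ≤
      ε * bergmanEnergy r f + ε⁻¹ * (hypNormalizer r - hypNormalizer s) := by
  have hsub : ball (0 : ℂ) s ⊆ ball 0 r := ball_subset_ball hsr
  have hmass : IntegrableOn (fun z => ‖f z‖) (ball 0 r) normArea :=
    integrableOn_ball_of_continuous (by fun_prop) r
  have henergy : IntegrableOn (fun z : ℂ => (1 - ‖z‖ ^ 2) * ‖f z‖ ^ 2) (ball 0 r) normArea :=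
    integrableOn_ball_of_continuous (by fun_prop) r
  have harea := integrableOn_ball_one_div_one_sub_sq_norm hr
  have hpos : ∀ᵐ z ∂normArea.restrict (ball 0 r \ ball 0 s), 0 < 1 - ‖z‖ ^ 2 := by
    filter_upwards [ae_restrict_mem (measurableSet_ball.diff measurableSet_ball)] with z hz
    exact one_sub_sq_norm_pos ((mem_ball_zero_iff.1 hz.1).trans hr)
  rw [diskMass, diskMass, hypNormalizer, hypNormalizer,
    ← setIntegral_sdiff measurableSet_ball hmass hsub,
    ← setIntegral_sdiff measurableSet_ball harea hsub]
  refine (two_mul_integral_le_of_pos hpos (hmass.mono_set sdiff_subset)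
    (henergy.mono_set sdiff_subset) (harea.mono_set sdiff_subset) hε).trans ?_
  gcongr
  exact setIntegral_one_sub_sq_norm_mul_le_bergmanEnergy hf sdiff_subset hr.le

lemma sq_mul_bergmanEnergy_dilation_le (hf : Continuous f) {r : ℝ} (hr0 : 0 < r) (hr1 : r ≤ 1) :
    r ^ 2 * bergmanEnergy 1 (fun z => f (r • z)) ≤ bergmanEnergy r f := by
  have hscale := Measure.setIntegral_comp_smul_of_pos normArea
    (fun z => (1 - (‖z‖ / r) ^ 2) * ‖f z‖ ^ 2) (ball 0 1) hr0
  simp only [norm_smul, Real.norm_of_nonneg hr0.le, mul_div_cancel_left₀ _ hr0.ne',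
    Complex.finrank_real_complex, smul_unitBall_of_pos hr0, smul_eq_mul] at hscale
  rw [bergmanEnergy, hscale, mul_inv_cancel_left₀ (by positivity)]
  refine setIntegral_mono_on (integrableOn_ball_of_continuous (by fun_prop) r)
    (integrableOn_ball_of_continuous (by fun_prop) r) measurableSet_ball fun z _ => ?_
  gcongr
  exact le_div_self (norm_nonneg z) hr0 hr1

lemma sq_mul_diskMass_dilation {r : ℝ} (hr : 0 < r) (s : ℝ) :
    r ^ 2 * diskMass s (fun z => f (r • z)) = diskMass (r * s) f := by
  rw [diskMass, Measure.setIntegral_comp_smul_of_pos normArea (fun z => ‖f z‖) _ hr,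
    Complex.finrank_real_complex, smul_eq_mul, mul_inv_cancel_left₀ (by positivity),
    _root_.smul_ball hr.ne', smul_zero, Real.norm_of_nonneg hr.le]
  rfl

end ContinuousFunction

section DiscrepancyFunctional

variable {r : ℝ}

lemma rhoHr_eq (hr0 : 0 < r) (hr1 : r < 1) (f : Polynomial ℂ) :
    rhoHr r f =
      (bergmanEnergy r (fun z => f.eval z) - 2 * diskMass r fun z => f.eval z) / hypNormalizer r
        + 1 := by
  rw [rhoHr, setIntegral_hypDiscrepancy_div f.continuous hr1 le_rfl hr1.le, add_div,
    div_self (hypNormalizer_pos hr0 hr1).ne']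

lemma rhoHrStar_eq (hr0 : 0 < r) (hr1 : r < 1) (f : Polynomial ℂ) :
    rhoHrStar r f =
      (bergmanEnergy 1 (fun z => f.eval z) - 2 * diskMass r fun z => f.eval z) / hypNormalizer r
        + 1 := by
  rw [rhoHrStar, setIntegral_hypDiscrepancy_div f.continuous hr1 hr1.le le_rfl, add_div,
    div_self (hypNormalizer_pos hr0 hr1).ne']

lemma rhoHr_nonneg (hr0 : 0 < r) (hr1 : r < 1) (f : Polynomial ℂ) : 0 ≤ rhoHr r f :=
  div_nonneg (setIntegral_nonneg measurableSet_ball fun _ hz => div_nonneg (sq_nonneg _)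
    (one_sub_sq_norm_pos ((mem_ball_zero_iff.1 hz).trans hr1)).le) (hypNormalizer_pos hr0 hr1).le

lemma rhoHr_le_rhoHrStar (hr0 : 0 < r) (hr1 : r < 1) (f : Polynomial ℂ) :
    rhoHr r f ≤ rhoHrStar r f := by
  have hN := hypNormalizer_pos hr0 hr1
  rw [rhoHr_eq hr0 hr1, rhoHrStar_eq hr0 hr1]
  gcongr
  exact setIntegral_one_sub_sq_norm_mul_le_bergmanEnergy f.continuous (ball_subset_ball hr1.le)
    le_rfl

lemma rhoHr_zero (hr0 : 0 < r) (hr1 : r < 1) : rhoHr r 0 = 1 := by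
  simp [rhoHr_eq hr0 hr1, bergmanEnergy, diskMass]

lemma bergmanEnergy_le (hr0 : 0 < r) (hr1 : r < 1) (f : Polynomial ℂ) :
    bergmanEnergy r (fun z => f.eval z) ≤ 2 * (rhoHr r f + 1) * hypNormalizer r := by
  have hN := hypNormalizer_pos hr0 hr1
  have hmass : 2 * diskMass r (fun z => f.eval z) ≤
      1 / 2 * bergmanEnergy r (fun z => f.eval z) + 2 * hypNormalizer r := by
    simpa [diskMass, hypNormalizer] using
      two_mul_diskMass_sub_le f.continuous hr0.le hr1 (one_half_pos (α := ℝ))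
  rw [rhoHr_eq hr0 hr1]
  field_simp
  linarith

lemma sq_mul_rhoHrStar_dilation_le (hr0 : 0 < r) (hr1 : r < 1) (f : Polynomial ℂ) :
    r ^ 2 * rhoHrStar r (f.comp (.C (r : ℂ) * .X)) ≤ rhoHr r f +
      2 * (diskMass r (fun z => f.eval z) - diskMass (r ^ 2) fun z => f.eval z) /
        hypNormalizer r := by
  have hN := hypNormalizer_pos hr0 hr1
  have hdil : (fun z => (f.comp (.C (r : ℂ) * .X)).eval z) = fun z => f.eval (r • z) := by
    ext z
    simp
  have henergy := sq_mul_bergmanEnergy_dilation_le f.continuous hr0 hr1.le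
  have hmass := sq_mul_diskMass_dilation (f := fun z => f.eval z) hr0 r
  have hsq : r ^ 2 ≤ 1 := pow_le_one₀ hr0.le hr1.le
  rw [rhoHrStar_eq hr0 hr1, hdil, rhoHr_eq hr0 hr1]
  rw [← sq] at hmass
  field_simp
  nlinarith

lemma sq_mul_rhoHrStar_dilation_le_of_pos (hr0 : 0 < r) (hr1 : r < 1) {ε : ℝ} (hε : 0 < ε)
    (f : Polynomial ℂ) :
    r ^ 2 * rhoHrStar r (f.comp (.C (r : ℂ) * .X)) ≤
      (1 + 2 * ε) * rhoHr r f + (2 * ε + (ε * hypNormalizer r)⁻¹) := by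
  have hN := hypNormalizer_pos hr0 hr1
  have hloss : 2 * (diskMass r (fun z => f.eval z) - diskMass (r ^ 2) fun z => f.eval z) ≤
      ε * (2 * (rhoHr r f + 1) * hypNormalizer r) + ε⁻¹ * 1 := by
    refine (two_mul_diskMass_sub_le f.continuous (by nlinarith : r ^ 2 ≤ r) hr1 hε).trans ?_
    gcongr
    · exact bergmanEnergy_le hr0 hr1 f
    · exact hypNormalizer_sub_hypNormalizer_sq_le_one hr0.le hr1
  calc r ^ 2 * rhoHrStar r (f.comp (.C (r : ℂ) * .X))
      ≤ rhoHr r f + (ε * (2 * (rhoHr r f + 1) * hypNormalizer r) + ε⁻¹ * 1) / hypNormalizer r :=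
        (sq_mul_rhoHrStar_dilation_le hr0 hr1 f).trans (by gcongr)
    _ = (1 + 2 * ε) * rhoHr r f + (2 * ε + (ε * hypNormalizer r)⁻¹) := by
        field_simp
        ring

lemma bddBelow_range_rhoHr (hr0 : 0 < r) (hr1 : r < 1) : BddBelow (range (rhoHr r)) :=
  ⟨0, forall_mem_range.2 (rhoHr_nonneg hr0 hr1)⟩

lemma bddBelow_range_rhoHrStar (hr0 : 0 < r) (hr1 : r < 1) : BddBelow (range (rhoHrStar r)) :=
  ⟨0, forall_mem_range.2 fun f => (rhoHr_nonneg hr0 hr1 f).trans (rhoHr_le_rhoHrStar hr0 hr1 f)⟩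

lemma iInf_rhoHr_mem_Icc (hr0 : 0 < r) (hr1 : r < 1) : ⨅ f, rhoHr r f ∈ Icc 0 1 :=
  ⟨le_ciInf (rhoHr_nonneg hr0 hr1),
    ciInf_le_of_le (bddBelow_range_rhoHr hr0 hr1) 0 (rhoHr_zero hr0 hr1).le⟩

lemma sq_mul_iInf_rhoHrStar_le (hr0 : 0 < r) (hr1 : r < 1) {ε : ℝ} (hε : 0 < ε) :
    r ^ 2 * ⨅ f, rhoHrStar r f ≤
      (1 + 2 * ε) * (⨅ f, rhoHr r f) + (2 * ε + (ε * hypNormalizer r)⁻¹) := by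
  rw [← sub_le_iff_le_add, Real.mul_iInf_of_nonneg (by positivity : 0 ≤ 1 + 2 * ε)]
  refine le_ciInf fun f => sub_le_iff_le_add.2 ?_
  refine le_trans ?_ (sq_mul_rhoHrStar_dilation_le_of_pos hr0 hr1 hε f)
  gcongr
  exact ciInf_le (bddBelow_range_rhoHrStar hr0 hr1) _

lemma iInf_rhoHrStar_sub_iInf_rhoHr_le (hr0 : 0 < r) (hr1 : r < 1) :
    (⨅ f, rhoHrStar r f) - ⨅ f, rhoHr r f ≤
      (1 + 5 * (√(hypNormalizer r))⁻¹) / r ^ 2 - 1 := by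
  have hN := hypNormalizer_pos hr0 hr1
  have hI := (iInf_rhoHr_mem_Icc hr0 hr1).2
  -- `ε = N(r)^(-1/2)` balances the two error terms `2ε` and `1 / (ε N(r))`
  set δ := (√(hypNormalizer r))⁻¹ with hδ
  have hδ0 : 0 < δ := by positivity
  have hδN : (δ * hypNormalizer r)⁻¹ = δ := by
    rw [hδ, inv_mul_eq_div, Real.div_sqrt]
  have hstar := sq_mul_iInf_rhoHrStar_le hr0 hr1 hδ0
  rw [hδN] at hstar
  have hsq : r ^ 2 ≤ 1 := pow_le_one₀ hr0.le hr1.le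
  rw [le_sub_iff_add_le, le_div_iff₀ (by positivity)]
  nlinarith [mul_nonneg (sub_nonneg.2 hsq) (sub_nonneg.2 hI),
    mul_nonneg hδ0.le (sub_nonneg.2 hI)]

end DiscrepancyFunctional

theorem tendsto_iInf_rhoHrStar_sub_iInf_rhoHr :
    Tendsto (fun r => (⨅ f, rhoHrStar r f) - ⨅ f, rhoHr r f) (𝓝[<] 1) (𝓝 0) := by
  have hδ : Tendsto (fun r => (√(hypNormalizer r))⁻¹) (𝓝[<] 1) (𝓝 0) :=
    (Real.tendsto_sqrt_atTop.comp tendsto_hypNormalizer_atTop).inv_tendsto_atTop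
  have hsq : Tendsto (fun r : ℝ => r ^ 2) (𝓝[<] 1) (𝓝 1) :=
    tendsto_nhdsWithin_of_tendsto_nhds (Continuous.tendsto' (by fun_prop) _ _ (by simp))
  have hbound : Tendsto (fun r => (1 + 5 * (√(hypNormalizer r))⁻¹) / r ^ 2 - 1) (𝓝[<] 1) (𝓝 0) := by
    simpa using (((hδ.const_mul 5).const_add 1).div hsq one_ne_zero).sub_const 1
  have hmem : ∀ᶠ r : ℝ in 𝓝[<] 1, r ∈ Ioo 0 1 := Ioo_mem_nhdsLT zero_lt_one
  refine tendsto_of_tendsto_of_tendsto_of_le_of_le' tendsto_const_nhds hbound ?_ ?_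
  · exact hmem.mono fun r hr => sub_nonneg.2
      (ciInf_mono (bddBelow_range_rhoHr hr.1 hr.2) (rhoHr_le_rhoHrStar hr.1 hr.2))
  · exact hmem.mono fun r hr => iInf_rhoHrStar_sub_iInf_rhoHr_le hr.1 hr.2

/-- The hyperbolic discrepancy density equals its tight version. -/
theorem theorem1p2 : rhoH = rhoHStar := by
  have hmem : ∀ᶠ r in 𝓝[<] (1 : ℝ), ⨅ f, rhoHr r f ∈ Icc 0 1 := by
    filter_upwards [Ioo_mem_nhdsLT (zero_lt_one' ℝ)] with r hr using iInf_rhoHr_mem_Icc hr.1 hr.2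
  exact liminf_eq_liminf_of_tendsto_sub
    (isBoundedUnder_of_eventually_le (hmem.mono fun r hr => hr.2))
    (isBoundedUnder_of_eventually_ge (hmem.mono fun r hr => hr.1))
    tendsto_iInf_rhoHrStar_sub_iInf_rhoHr
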